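/- Let $R$ be a commutative principal ideal domain, $\sigma$ a ring automorphism of $R$ and $0\neq a\in R$. Let $A=R(\sigma,a)$ be the generalized Weyl algebra generated by $R$, $x$, $y$ subject to $$x\,\sigma(r)=r\,x,\qquad y\,r=\sigma(r)\,y,\qquad xy=a,\qquad yx=\sigma(a)\qquad(r\in R).$$ For a divisor $p$ of $a$ put $q=\sigma(a/p)$, so that $a=\sigma^{-1}(q)\,p$, and let $V_p$ be the $A$-module with underlying abelian group $R$ and action $r'\cdot r=r'r$, $x\cdot r=\sigma^{-1}(r)\,p$, $y\cdot r=\sigma(r)\,q$. Let $\mathsf{Irr}(R)$ be the set of classes $[r]$ of irreducible elements $r$ of $R$ up to associates, on which $\sigma$ acts; the $\sigma$-orbit of $[r]$ is $\{[\sigma^k(r)] : k\in\mathbb{Z}\}$. For $0\ne r\in R$ let $\deg(r)$ be the number of irreducible factors of $r$, counted with multiplicity. Let $\mathscr{C}_1$ be the full subcategory of $A$-modules whose restriction to $R$ is free of rank $1$ (isomorphic to ${}_RR$). Assume that all $\sigma$-orbits in $\mathsf{Irr}(R)$ are infinite. Then: 1. for every divisor $p$ of $a$, the length of the $A$-module $V_p$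 is at most $1+\deg(p)\cdot\deg(q)$; 2. every object of $\mathscr{C}_1$ has finite length as an $A$-module, and its length is at most $1+\left(\frac{\deg(a)}{2}\right)^2$. -/

import Mathlib

universe u v

/-- Generators of the generalized Weyl algebra: the elements of `R`, and `x`, `y`. -/
inductive GWAGen (R : Type u) : Type u
  | base (r : R) : GWAGen R
  | x : GWAGen R
  | y : GWAGen R

/-- The formal monomial of degree one attached to a generator. -/
noncomputable abbrev GWAGen.mono {R : Type u} (g : GWAGen R) : FreeAlgebra ℤ (GWAGen R) :=
  FreeAlgebra.ι ℤ g

/-- Defining relations of `R(σ, a)`. The first three say that `R` maps to it by a unital ring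
homomorphism; the last four are `x σ(r) = r x`, `y r = σ(r) y`, `x y = a`, `y x = σ(a)`. -/
inductive GWARel {R : Type u} [Ring R] (σ : RingAut R) (a : R) :
    FreeAlgebra ℤ (GWAGen R) → FreeAlgebra ℤ (GWAGen R) → Prop
  | base_one : GWARel σ a (GWAGen.base 1).mono 1
  | base_add (r s : R) : GWARel σ a (GWAGen.base (r + s)).mono
      ((GWAGen.base r).mono + (GWAGen.base s).mono)
  | base_mul (r s : R) : GWARel σ a (GWAGen.base (r * s)).mono
      ((GWAGen.base r).mono * (GWAGen.base s).mono)
  | x_base (r : R) : GWARel σ a (GWAGen.x.mono * (GWAGen.base (σ r)).mono)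
      ((GWAGen.base r).mono * GWAGen.x.mono)
  | y_base (r : R) : GWARel σ a (GWAGen.y.mono * (GWAGen.base r).mono)
      ((GWAGen.base (σ r)).mono * GWAGen.y.mono)
  | x_y : GWARel σ a (GWAGen.x.mono * GWAGen.y.mono) (GWAGen.base a).mono
  | y_x : GWARel σ a (GWAGen.y.mono * GWAGen.x.mono) (GWAGen.base (σ a)).mono

/-- The generalized Weyl algebra `R(σ, a)` (for `a` a central element of `R`). -/
abbrev GWA {R : Type u} [Ring R] (σ : RingAut R) (a : R) : Type u :=
  RingQuot (GWARel σ a)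

namespace GWA

section General

variable {R : Type u} [Ring R] (σ : RingAut R) (a : R)

/-- The class of a generator in `R(σ, a)`. -/
noncomputable def gen (g : GWAGen R) : GWA σ a :=
  RingQuot.mkRingHom (GWARel σ a) g.mono

/-- The generator `x`. -/
noncomputable def x : GWA σ a := gen σ a GWAGen.x

/-- The generator `y`. -/
noncomputable def y : GWA σ a := gen σ a GWAGen.y

/-- The canonical ring homomorphism `R → R(σ, a)`. -/
noncomputable def ofBase : R →+* GWA σ a :=
  RingHom.mk'
    { toFun := fun r => gen σ a (GWAGen.base r)
      map_one' := by
        simpa [gen] using RingQuot.mkRingHom_rel (GWARel.base_one (σ := σ) (a := a))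
      map_mul' := fun r s => by
        simpa [gen] using RingQuot.mkRingHom_rel (GWARel.base_mul (σ := σ) (a := a) r s) }
    (fun r s => by
        simpa [gen] using RingQuot.mkRingHom_rel (GWARel.base_add (σ := σ) (a := a) r s))

/-- Membership in the category `𝒞ₙ`: the restriction of the `R(σ, a)`-module `V` along
`R → R(σ, a)` is isomorphic to the left `R`-module `Rⁿ`. -/
def IsFreeOfRank (n : ℕ) (V : Type v) [AddCommGroup V] [Module (GWA σ a) V] : Prop :=
  letI : Module R V := Module.compHom V (ofBase σ a)
  Nonempty (V ≃ₗ[R] (Fin n → R))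

end General

section RankOne

variable {R : Type u} [CommRing R] (σ : RingAut R) (a p : R)

/-- The element `q = σ(a / p)` attached to a divisor `p` of `a`. The quotient `a / p` is some `c`
with `a = p * c`; it is unique when `R` is a domain and `a ≠ 0`. -/
noncomputable def coDivisor (hp : p ∣ a) : R := σ hp.choose

theorem symm_coDivisor_mul (hp : p ∣ a) : σ.symm (coDivisor σ a p hp) * p = a := by
  unfold coDivisor
  rw [RingEquiv.symm_apply_apply, mul_comm]
  exact hp.choose_spec.symm

/-- The action of the generators on `V_p`: `r' · r = r' r`, `x · r = σ⁻¹(r) p`,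
`y · r = σ(r) q`. -/
noncomputable def actGen (hp : p ∣ a) : GWAGen R → AddMonoid.End R
  | GWAGen.base r' => AddMonoidHom.mk' (fun r => r' * r) (fun r s => mul_add r' r s)
  | GWAGen.x => AddMonoidHom.mk' (fun r => σ.symm r * p) (fun r s => by rw [map_add, add_mul])
  | GWAGen.y => AddMonoidHom.mk' (fun r => σ r * coDivisor σ a p hp)
      (fun r s => by rw [map_add, add_mul])

/-- The representation of `R(σ, a)` on the abelian group `R` extending `actGen`. -/
noncomputable def act (hp : p ∣ a) : GWA σ a →+* AddMonoid.End R :=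
  RingQuot.lift
    ⟨(FreeAlgebra.lift ℤ (actGen σ a p hp) :
        FreeAlgebra ℤ (GWAGen R) →ₐ[ℤ] AddMonoid.End R).toRingHom, by
      have h : σ.symm (coDivisor σ a p hp) * p = a := symm_coDivisor_mul σ a p hp
      have h' : coDivisor σ a p hp * σ p = σ a := by
        simpa using congrArg σ h
      intro u w huw
      cases huw <;> refine AddMonoidHom.ext fun t => ?_ <;>
        simp only [AlgHom.toRingHom_eq_coe, RingHom.coe_coe, map_mul, map_add, map_one,
          FreeAlgebra.lift_ι_apply]
      case base_one => exact one_mul t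
      case base_add r s => exact add_mul r s t
      case base_mul r s => exact mul_assoc r s t
      case x_base r =>
        change σ.symm (σ r * t) * p = r * (σ.symm t * p)
        rw [map_mul, RingEquiv.symm_apply_apply, mul_assoc]
      case y_base r =>
        change σ (r * t) * coDivisor σ a p hp = σ r * (σ t * coDivisor σ a p hp)
        rw [map_mul, mul_assoc]
      case x_y =>
        change σ.symm (σ t * coDivisor σ a p hp) * p = a * t
        rw [map_mul, RingEquiv.symm_apply_apply, mul_assoc, h, mul_comm]
      case y_x =>
        change σ (σ.symm t * p) * coDivisor σ a p hp = σ a * t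
        rw [map_mul, RingEquiv.apply_symm_apply, mul_assoc, mul_comm (σ p), h', mul_comm]⟩

end RankOne

end GWA

/-- The carrier of the rank one module `V_p`, for a divisor `p` of `a`: the abelian group `R`. -/
def VMod {R : Type u} [CommRing R] (_σ : RingAut R) (a p : R) (_hp : p ∣ a) : Type u := R

namespace VMod

variable {R : Type u} [CommRing R] {σ : RingAut R} {a p : R} {hp : p ∣ a}

instance : AddCommGroup (VMod σ a p hp) := inferInstanceAs (AddCommGroup R)

/-- The `R(σ, a)`-module structure of `V_p`. -/
noncomputable instance : Module (GWA σ a) (VMod σ a p hp) :=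
  Module.compHom R (GWA.act σ a p hp)

theorem ofBase_smul (r' r : R) :
    GWA.ofBase σ a r' • (show VMod σ a p hp from r) = (r' * r : R) := by
  change GWA.act σ a p hp (RingQuot.mkRingHom _ _) r = _
  simp only [GWA.act, RingQuot.lift_mkRingHom_apply, AlgHom.toRingHom_eq_coe, RingHom.coe_coe,
    FreeAlgebra.lift_ι_apply]
  rfl

theorem x_smul (r : R) :
    GWA.x σ a • (show VMod σ a p hp from r) = (σ.symm r * p : R) := by
  change GWA.act σ a p hp (RingQuot.mkRingHom _ _) r = _
  simp only [GWA.act, RingQuot.lift_mkRingHom_apply, AlgHom.toRingHom_eq_coe, RingHom.coe_coe,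
    FreeAlgebra.lift_ι_apply]
  rfl

theorem y_smul (r : R) :
    GWA.y σ a • (show VMod σ a p hp from r) = (σ r * GWA.coDivisor σ a p hp : R) := by
  change GWA.act σ a p hp (RingQuot.mkRingHom _ _) r = _
  simp only [GWA.act, RingQuot.lift_mkRingHom_apply, AlgHom.toRingHom_eq_coe, RingHom.coe_coe,
    FreeAlgebra.lift_ι_apply]
  rfl

end VMod

/-- `Irr(R)`: the irreducible elements of `R` up to associates. -/
def IrrClasses (R : Type u) [CommRing R] : Set (Associates R) :=
  {c | ∃ r : R, Irreducible r ∧ Associates.mk r = c}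

/-- The orbit of a class of associates under the group generated by `σ`. -/
def sigmaOrbit {R : Type u} [CommRing R] (σ : RingAut R) (c : Associates R) :
    Set (Associates R) :=
  {c' | ∃ (r : R) (k : ℤ), Associates.mk r = c ∧ Associates.mk ((σ ^ k : RingAut R) r) = c'}

theorem sigmaOrbit_mk {R : Type u} [CommRing R] (σ : RingAut R) (r : R) :
    sigmaOrbit σ (Associates.mk r) =
      Set.range fun k : ℤ => Associates.mk ((σ ^ k : RingAut R) r) := by
  ext c'
  constructor
  · rintro ⟨s, k, hs, rfl⟩
    refine ⟨k, ?_⟩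
    rw [Associates.mk_eq_mk_iff_associated] at hs
    exact Associates.mk_eq_mk_iff_associated.2 (hs.symm.map ((σ ^ k : RingAut R) : R →* R))
  · rintro ⟨k, rfl⟩
    exact ⟨r, k, rfl, rfl⟩

/-- `Irr(r)`: the multiset of classes of irreducible factors of `r ≠ 0`. -/
noncomputable def irrFactors {R : Type u} [CommRing R] [IsDomain R]
    [UniqueFactorizationMonoid R] (r : R) : Multiset (Associates R) :=
  (UniqueFactorizationMonoid.factors r).map Associates.mk

/-- `deg(r)`: the number of irreducible factors of `r ≠ 0`, with multiplicity. -/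
noncomputable def irrDeg {R : Type u} [CommRing R] [IsDomain R]
    [UniqueFactorizationMonoid R] (r : R) : ℕ :=
  (irrFactors r).card

/-! A nonzero submodule of a rank one module is an ideal (f) such that f divides σ⁻¹(f)p and σ(f)q.
It is again of rank one, with parameters p' = σ⁻¹(f)p/f and q' = σ(f)q/f of the same degrees as p
and q. Count the pairs (c, d) in Irr(q) × Irr(p) with d = σⁿ(c) for some n ≥ 0: there are at most
deg(p)·deg(q). Since no class is periodic, this count drops strictly on passing to a smaller nonzero
submodule (`pairCount_reaches_lt`, `inversions_lt`). The zero submodule adds one more step, whence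
the bound 1 + deg(p)·deg(q). The second claim follows by choosing coordinates (`exists_coordinates`)
and the inequality between arithmetic and geometric means. -/

/-! ### Counting pairs along the orbits of a permutation. -/

section PairCount

open scoped Classical in
/-- The number of pairs in `s × t`, counted with multiplicity, satisfying the relation `ρ`. -/
noncomputable def pairCount {α : Type*} (ρ : α → α → Prop) (s t : Multiset α) : ℕ :=
  (s.map fun c => t.countP (ρ c)).sum

variable {α : Type*} (ρ : α → α → Prop)

theorem pairCount_add_left (s s' t : Multiset α) :
    pairCount ρ (s + s') t = pairCount ρ s t + pairCount ρ s' t := by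
  simp [pairCount]

theorem pairCount_add_right (s t t' : Multiset α) :
    pairCount ρ s (t + t') = pairCount ρ s t + pairCount ρ s t' := by
  simp [pairCount, Multiset.countP_add, Multiset.sum_map_add]

theorem pairCount_le (s t : Multiset α) : pairCount ρ s t ≤ s.card * t.card := by
  classical
  have h := Multiset.sum_le_card_nsmul (s.map fun c => t.countP (ρ c)) t.card (by
    intro x hx
    obtain ⟨c, -, rfl⟩ := Multiset.mem_map.1 hx
    exact Multiset.countP_le_card _ _)
  simpa [pairCount] using h

/-- `d` lies on the forward orbit of `c` under `τ`. -/
def Reaches (τ : Equiv.Perm α) (c d : α) : Prop := ∃ n : ℕ, (τ ^ n) c = d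

/-- `c` is not a periodic point of `τ`. -/
def Aperiodic (τ : Equiv.Perm α) (c : α) : Prop := ∀ n : ℕ, (τ ^ (n + 1)) c ≠ c

variable (τ : Equiv.Perm α)

theorem reaches_iff (c d : α) : Reaches τ c d ↔ c = d ∨ Reaches τ (τ c) d := by
  constructor
  · rintro ⟨_ | n, h⟩
    · exact Or.inl (by simpa using h)
    · exact Or.inr ⟨n, by rwa [pow_succ] at h⟩
  · rintro (rfl | ⟨n, h⟩)
    · exact ⟨0, by simp⟩
    · exact ⟨n + 1, by rwa [pow_succ]⟩

theorem reaches_symm_right (c d : α) : Reaches τ c (τ.symm d) ↔ Reaches τ (τ c) d := by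
  unfold Reaches
  refine exists_congr fun n => ?_
  rw [Equiv.eq_symm_apply, ← Equiv.Perm.mul_apply, ← Equiv.Perm.mul_apply, ← pow_succ,
    ← pow_succ']

theorem pairCount_reaches_symm_right (s t : Multiset α) :
    pairCount (Reaches τ) s (t.map τ.symm) = pairCount (Reaches τ) (s.map τ) t := by
  classical
  simp only [pairCount, Multiset.map_map, Multiset.countP_map, Function.comp_apply,
    reaches_symm_right, ← Multiset.countP_eq_card_filter]

variable {τ}

/-- Aperiodicity makes the two alternatives of `reaches_iff` exclusive, so their counts add up. -/
theorem pairCount_reaches (s t : Multiset α) (hs : ∀ c ∈ s, Aperiodic τ c) :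
    pairCount (Reaches τ) s t =
      pairCount (Reaches τ) (s.map τ) t + pairCount Eq s t := by
  classical
  simp only [pairCount, Multiset.map_map, Function.comp_apply]
  rw [← Multiset.sum_map_add]
  congr 1
  refine Multiset.map_congr rfl fun c hc => ?_
  induction t using Multiset.induction with
  | empty => simp
  | cons d t ih =>
    have hd : ¬ (c = d ∧ Reaches τ (τ c) d) := by
      rintro ⟨rfl, n, hn⟩
      exact hs c hc n (by rwa [pow_succ])
    simp only [Multiset.countP_cons, ih, reaches_iff τ c d]
    by_cases h1 : c = d <;> by_cases h2 : Reaches τ (τ c) d <;> simp_all <;> omega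

theorem pairCount_eq_pos {s t : Multiset α} {c : α} (hs : c ∈ s) (ht : c ∈ t) :
    0 < pairCount Eq s t := by
  classical
  obtain ⟨s, rfl⟩ := Multiset.exists_cons_of_mem hs
  simp only [pairCount, Multiset.map_cons, Multiset.sum_cons]
  exact Nat.add_pos_left (Multiset.countP_pos.2 ⟨c, ht, rfl⟩) _

/-- A nonzero finite multiset of aperiodic points is not invariant. -/
theorem map_ne_self_of_aperiodic {s : Multiset α} (hs : ∀ c ∈ s, Aperiodic τ c) (h0 : s ≠ 0) :
    s.map τ ≠ s := by
  intro h
  obtain ⟨c, hc⟩ := Multiset.exists_mem_of_ne_zero h0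
  have h1 := pairCount_reaches s s hs
  have h2 := pairCount_eq_pos hc hc
  rw [h] at h1
  omega

/-- If `F` and `P` were disjoint, the equation would force `F ≤ F.map τ.symm`. Equal cardinalities
then make `F` invariant, which aperiodicity forbids. -/
theorem exists_mem_of_add_eq {P P' F : Multiset α} (hF : ∀ c ∈ F, Aperiodic τ c) (h0 : F ≠ 0)
    (hP : P' + F = F.map τ.symm + P) : ∃ c ∈ F, c ∈ P := by
  classical
  by_contra! hdis
  have hle : F ≤ F.map τ.symm := by
    refine Multiset.le_iff_count.2 fun c => ?_
    by_cases hc : c ∈ F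
    · have h := congrArg (Multiset.count c) hP
      rw [Multiset.count_add, Multiset.count_add, Multiset.count_eq_zero.2 (hdis c hc)] at h
      omega
    · simp [Multiset.count_eq_zero.2 hc]
  have heq : F = F.map τ.symm := Multiset.eq_of_le_of_card_le hle (by simp)
  refine map_ne_self_of_aperiodic hF h0 ?_
  conv_lhs => rw [heq]
  simp

/-- Write ⟨S, T⟩ for the number of reaching pairs and E(S, T) for the number of equal pairs. Pairing
the first equation with Q' gives ⟨Q', P'⟩ + E(Q', F) = ⟨Q', P⟩; pairing the second with P gives ⟨Q',
P⟩ + E(F, P) = ⟨Q, P⟩. Finally E(F, P) > 0, because F and P share a point. -/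
theorem pairCount_reaches_lt {P P' Q Q' F : Multiset α} (hF : ∀ c ∈ F, Aperiodic τ c)
    (hQ' : ∀ c ∈ Q', Aperiodic τ c) (h0 : F ≠ 0)
    (hP : P' + F = F.map τ.symm + P) (hQ : Q' + F = F.map τ + Q) :
    pairCount (Reaches τ) Q' P' < pairCount (Reaches τ) Q P := by
  obtain ⟨c, hcF, hcP⟩ := exists_mem_of_add_eq hF h0 hP
  have hpos := pairCount_eq_pos hcF hcP
  have h1 := congrArg (pairCount (Reaches τ) Q') hP
  rw [pairCount_add_right, pairCount_add_right, pairCount_reaches_symm_right,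
    pairCount_reaches Q' F hQ'] at h1
  have h2 := congrArg (pairCount (Reaches τ) · P) hQ
  simp only [pairCount_add_left] at h2
  rw [pairCount_reaches F P hF] at h2
  omega

end PairCount
-- Irreducible factors and the action of σ on them.
section Factors

variable {R : Type u} [CommRing R]

/-- The permutation of the classes of associates induced by a ring automorphism. -/
def assocPerm (σ : RingAut R) : Equiv.Perm (Associates R) :=
  Quotient.congr σ.toEquiv fun r s =>
    ⟨fun h => h.map (σ : R →* R), fun h => by
      have h' : Associated _ _ := Associated.map (σ.symm : R →* R) h
      have h'' : Associated r s := by simpa using h'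
      exact h''⟩

theorem assocPerm_mk (σ : RingAut R) (r : R) :
    assocPerm σ (Associates.mk r) = Associates.mk (σ r) := rfl

theorem assocPerm_symm_mk (σ : RingAut R) (r : R) :
    (assocPerm σ).symm (Associates.mk r) = Associates.mk (σ.symm r) := rfl

theorem assocPerm_pow_mk (σ : RingAut R) (n : ℕ) (r : R) :
    (assocPerm σ ^ n) (Associates.mk r) = Associates.mk ((σ ^ n : RingAut R) r) := by
  induction n with
  | zero => rfl
  | succ n ih => rw [pow_succ', Equiv.Perm.mul_apply, ih, assocPerm_mk, pow_succ']; rfl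

theorem mk_zpow_apply_eq {σ : RingAut R} {r : R}
    (h : Associates.mk (σ r) = Associates.mk r) (j : ℤ) :
    Associates.mk ((σ ^ j : RingAut R) r) = Associates.mk r := by
  have step (j : ℤ) : Associates.mk ((σ ^ (j + 1) : RingAut R) r) =
      Associates.mk ((σ ^ j : RingAut R) r) := by
    rw [zpow_add_one]
    exact congrArg (assocPerm (σ ^ j)) h
  induction j using Int.induction_on with
  | zero => rfl
  | succ n ih => rw [step, ih]
  | pred n ih => rw [← step, sub_add_cancel, ih]

theorem aperiodic_of_sigmaOrbit_infinite {σ : RingAut R} {c : Associates R}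
    (hc : (sigmaOrbit σ c).Infinite) : Aperiodic (assocPerm σ) c := by
  intro n hn
  obtain ⟨r, rfl⟩ := Associates.mk_surjective c
  rw [assocPerm_pow_mk] at hn
  refine hc (((Set.finite_Ico (0 : ℤ) (n + 1)).image
    fun k : ℤ => Associates.mk ((σ ^ k : RingAut R) r)).subset ?_)
  rw [sigmaOrbit_mk]
  rintro _ ⟨k, rfl⟩
  -- A class fixed by σⁿ⁺¹ has an orbit indexed by residues modulo n + 1, hence a finite one.
  refine ⟨k % (n + 1), ⟨Int.emod_nonneg _ (by omega), Int.emod_lt_of_pos _ (by omega)⟩, ?_⟩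
  have h := congrArg (assocPerm (σ ^ (k % (n + 1)))) (mk_zpow_apply_eq hn (k / (n + 1)))
  have hk : (σ ^ k : RingAut R) = σ ^ (k % (n + 1)) * (σ ^ (n + 1)) ^ (k / (n + 1)) := by
    rw [← zpow_natCast σ, ← zpow_mul, ← zpow_add]
    congr 1
    push_cast
    exact (Int.emod_add_mul_ediv k (n + 1)).symm
  change Associates.mk ((σ ^ (k % (n + 1)) : RingAut R) r) = Associates.mk ((σ ^ k : RingAut R) r)
  rw [hk]
  exact h.symm

variable [IsDomain R] [UniqueFactorizationMonoid R]

open UniqueFactorizationMonoid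

theorem irrFactors_mul {r s : R} (hr : r ≠ 0) (hs : s ≠ 0) :
    irrFactors (r * s) = irrFactors r + irrFactors s := by
  unfold irrFactors
  rw [← Multiset.map_add]
  exact Multiset.map_mk_eq_map_mk_of_rel (factors_mul hr hs)

theorem irrFactors_ringEquiv (σ : RingAut R) {r : R} (hr : r ≠ 0) :
    irrFactors (σ r) = (irrFactors r).map (assocPerm σ) := by
  have h : Multiset.Rel Associated (factors (σ r)) ((factors r).map σ) := by
    refine factors_unique irreducible_of_factor (fun x hx => ?_) ?_
    · obtain ⟨t, ht, rfl⟩ := Multiset.mem_map.1 hx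
      exact (MulEquiv.irreducible_iff σ).2 (irreducible_of_factor t ht)
    · refine (factors_prod (by simpa using hr)).trans ?_
      rw [← map_multiset_prod σ]
      exact ((factors_prod hr).map (σ : R →* R)).symm
  have h' := Multiset.map_mk_eq_map_mk_of_rel h
  unfold irrFactors
  rw [Multiset.map_map] at h' ⊢
  exact h'

theorem irrFactors_ringEquiv_symm (σ : RingAut R) {r : R} (hr : r ≠ 0) :
    irrFactors (σ.symm r) = (irrFactors r).map (assocPerm σ).symm :=
  irrFactors_ringEquiv (σ.symm : RingAut R) hr

theorem mem_irrClasses_of_mem_irrFactors {r : R} {c : Associates R} (hc : c ∈ irrFactors r) :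
    c ∈ IrrClasses R := by
  obtain ⟨t, ht, rfl⟩ := Multiset.mem_map.1 hc
  exact ⟨t, irreducible_of_factor t ht, rfl⟩

theorem irrFactors_eq_zero_iff {r : R} (hr : r ≠ 0) : irrFactors r = 0 ↔ IsUnit r := by
  rw [irrFactors, Multiset.map_eq_zero, factors_eq_zero hr]

theorem irrDeg_mul {r s : R} (hr : r ≠ 0) (hs : s ≠ 0) :
    irrDeg (r * s) = irrDeg r + irrDeg s := by
  simp [irrDeg, irrFactors_mul hr hs]

theorem irrDeg_ringEquiv (σ : RingAut R) {r : R} (hr : r ≠ 0) : irrDeg (σ r) = irrDeg r := by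
  simp [irrDeg, irrFactors_ringEquiv σ hr]

theorem irrDeg_ringEquiv_symm (σ : RingAut R) {r : R} (hr : r ≠ 0) :
    irrDeg (σ.symm r) = irrDeg r :=
  irrDeg_ringEquiv (σ.symm : RingAut R) hr

/-- The number of pairs of irreducible factors of `q` and `p` such that the second one lies on the
forward `σ`-orbit of the first one. -/
noncomputable def inversions (σ : RingAut R) (p q : R) : ℕ :=
  pairCount (Reaches (assocPerm σ)) (irrFactors q) (irrFactors p)

theorem inversions_le (σ : RingAut R) (p q : R) : inversions σ p q ≤ irrDeg p * irrDeg q :=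
  (pairCount_le _ _ _).trans_eq (mul_comm _ _)

/-- The two equations say that p', q' are the parameters of the submodule (g); taking factor
multisets turns them into those of `pairCount_reaches_lt`. -/
theorem inversions_lt {σ : RingAut R}
    (horb : ∀ c ∈ IrrClasses R, (sigmaOrbit σ c).Infinite) {p q p' q' g : R}
    (hp : p ≠ 0) (hq : q ≠ 0) (hg : g ≠ 0) (hgu : ¬ IsUnit g)
    (hp' : p' * g = σ.symm g * p) (hq' : q' * g = σ g * q) :
    inversions σ p' q' < inversions σ p q := by
  have hσ : σ g ≠ 0 := by simpa using hg
  have hσ' : σ.symm g ≠ 0 := by simpa using hg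
  have hp0 : p' ≠ 0 := left_ne_zero_of_mul (hp' ▸ mul_ne_zero hσ' hp)
  have hq0 : q' ≠ 0 := left_ne_zero_of_mul (hq' ▸ mul_ne_zero hσ hq)
  have haper {r : R} : ∀ c ∈ irrFactors r, Aperiodic (assocPerm σ) c := fun c hc =>
    aperiodic_of_sigmaOrbit_infinite (horb c (mem_irrClasses_of_mem_irrFactors hc))
  refine pairCount_reaches_lt (F := irrFactors g) haper haper
    (mt (irrFactors_eq_zero_iff hg).1 hgu) ?_ ?_
  · rw [← irrFactors_mul hp0 hg, hp', irrFactors_mul hσ' hp, irrFactors_ringEquiv_symm σ hg]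
  · rw [← irrFactors_mul hq0 hg, hq', irrFactors_mul hσ hq, irrFactors_ringEquiv σ hg]

end Factors

/-- Along a strict chain of submodules the values of `φ` increase by at least one at each step, so
no chain has more than `n` steps. -/
theorem Module.length_le_of_strictMono {A : Type*} {M : Type*} [Ring A] [AddCommGroup M]
    [Module A M] (φ : Submodule A M → ℕ) (hφ : StrictMono φ) {n : ℕ} (h : ∀ N, φ N ≤ n) :
    Module.length A M ≤ n := by
  rw [Module.length_eq_height]
  refine Order.height_le fun s _ => ?_
  have h1 := (s.map φ hφ).head_add_length_le_nat
  have h2 := h s.last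
  simp only [LTSeries.last_map, LTSeries.map_length] at h1
  exact_mod_cast (by omega : s.length ≤ n)

/-! ### Submodules and length of rank one modules. -/

namespace GWA

variable {R : Type u} [CommRing R] [IsPrincipalIdealRing R]
  {σ : RingAut R} {a p q : R} {V : Type v} [AddCommGroup V] [Module (GWA σ a) V]

/-- A nonzero submodule of a rank one module corresponds to an ideal `(f)` of `R` such that `f`
divides `σ⁻¹(f) p` and `σ(f) q`. -/
theorem exists_generator (e : R ≃+ V)
    (hbase : ∀ r s, ofBase σ a r • e s = e (r * s))
    (hx : ∀ r, x σ a • e r = e (σ.symm r * p)) (hy : ∀ r, y σ a • e r = e (σ r * q))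
    (N : Submodule (GWA σ a) V) (hN : N ≠ ⊥) :
    ∃ f p' q' : R, f ≠ 0 ∧ (∀ r, e r ∈ N ↔ f ∣ r) ∧
      p' * f = σ.symm f * p ∧ q' * f = σ f * q := by
  let I : Ideal R :=
    { carrier := {r | e r ∈ N}
      add_mem' := fun {r s} hr hs => by
        change e (r + s) ∈ N
        rw [map_add]
        exact N.add_mem hr hs
      zero_mem' := by
        change e 0 ∈ N
        rw [map_zero]
        exact N.zero_mem
      smul_mem' := fun r s hs => by
        change e (r * s) ∈ N
        rw [← hbase]
        exact N.smul_mem _ hs }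
  obtain ⟨f, hf⟩ := (IsPrincipalIdealRing.principal I).principal
  have hmem (r : R) : e r ∈ N ↔ f ∣ r := by
    rw [← Ideal.mem_span_singleton, ← Ideal.submodule_span_eq, ← hf]
    rfl
  have hfN : e f ∈ N := (hmem f).2 dvd_rfl
  obtain ⟨p', hp'⟩ := (hmem _).1 (hx f ▸ N.smul_mem _ hfN)
  obtain ⟨q', hq'⟩ := (hmem _).1 (hy f ▸ N.smul_mem _ hfN)
  refine ⟨f, p', q', ?_, hmem, by rw [hp', mul_comm], by rw [hq', mul_comm]⟩
  rintro rfl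
  refine hN ((Submodule.eq_bot_iff _).2 fun v hv => ?_)
  have h := (hmem (e.symm v)).1 (by simpa using hv)
  simpa using h

theorem length_le [IsDomain R] (horb : ∀ c ∈ IrrClasses R, (sigmaOrbit σ c).Infinite)
    (hp : p ≠ 0) (hq : q ≠ 0) (e : R ≃+ V)
    (hbase : ∀ r s, ofBase σ a r • e s = e (r * s))
    (hx : ∀ r, x σ a • e r = e (σ.symm r * p)) (hy : ∀ r, y σ a • e r = e (σ r * q)) :
    Module.length (GWA σ a) V ≤ ((1 + irrDeg p * irrDeg q : ℕ) : ℕ∞) := by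
  classical
  choose f p' q' hf hmem hp' hq' using exists_generator e hbase hx hy
  -- Comparing degrees in p'f = σ⁻¹(f)p and q'f = σ(f)q, where σ preserves degree.
  have hdeg (N) (hN : N ≠ ⊥) : irrDeg (p' N hN) = irrDeg p ∧ irrDeg (q' N hN) = irrDeg q := by
    have hσ : σ (f N hN) ≠ 0 := by simpa using hf N hN
    have hσ' : σ.symm (f N hN) ≠ 0 := by simpa using hf N hN
    have h1 := congrArg irrDeg (hp' N hN)
    have h2 := congrArg irrDeg (hq' N hN)
    rw [irrDeg_mul (left_ne_zero_of_mul (hp' N hN ▸ mul_ne_zero hσ' hp)) (hf N hN),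
      irrDeg_mul hσ' hp, irrDeg_ringEquiv_symm σ (hf N hN)] at h1
    rw [irrDeg_mul (left_ne_zero_of_mul (hq' N hN ▸ mul_ne_zero hσ hq)) (hf N hN),
      irrDeg_mul hσ hq, irrDeg_ringEquiv σ (hf N hN)] at h2
    omega
  refine Module.length_le_of_strictMono
    -- The summand 1 keeps nonzero submodules without inversions above the zero submodule.
    (fun N => if hN : N = ⊥ then 0 else 1 + inversions σ (p' N hN) (q' N hN)) ?_ ?_
  · intro N M hNM
    have hM : M ≠ ⊥ := (bot_le.trans_lt hNM).ne'
    by_cases hN : N = ⊥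
    · simp only [hN, hM, dite_true, dite_false]
      omega
    simp only [hN, hM, dite_false]
    obtain ⟨g, hg⟩ : f M hM ∣ f N hN :=
      (hmem M hM _).1 (hNM.le ((hmem N hN _).2 dvd_rfl))
    have hfM := hf M hM
    have hg0 : g ≠ 0 := right_ne_zero_of_mul (hg ▸ hf N hN)
    refine Nat.add_lt_add_left (inversions_lt horb (g := g) ?_ ?_ hg0 ?_ ?_ ?_) 1
    · refine left_ne_zero_of_mul (hp' M hM ▸ mul_ne_zero ?_ hp)
      simpa using hfM
    · refine left_ne_zero_of_mul (hq' M hM ▸ mul_ne_zero ?_ hq)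
      simpa using hfM
    -- If g were a unit, the generators of `N` and `M` would be associated and `M ≤ N`.
    · intro hu
      refine hNM.not_ge fun v hv => ?_
      obtain ⟨r, rfl⟩ := e.surjective v
      rw [hmem M hM] at hv
      rw [hmem N hN]
      rwa [hg, hu.mul_right_dvd]
    · have h := hp' N hN
      rw [hg, map_mul] at h
      -- The parameters of `N` relative to those of `M` are obtained by cancelling the generator of
      -- `M`.
      refine mul_right_cancel₀ hfM ?_
      linear_combination h - σ.symm g * hp' M hM
    · have h := hq' N hN
      rw [hg, map_mul] at h
      refine mul_right_cancel₀ hfM ?_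
      linear_combination h - σ g * hq' M hM
  · intro N
    split_ifs with hN
    · exact Nat.zero_le _
    · have h := inversions_le σ (p' N hN) (q' N hN)
      rw [(hdeg N hN).1, (hdeg N hN).2] at h
      exact Nat.add_le_add_left h 1

/-! ### Coordinates on modules free of rank one over R. -/

section Relations

variable {R : Type u} [Ring R] (σ : RingAut R) (a : R)

theorem x_mul_ofBase (r : R) : x σ a * ofBase σ a (σ r) = ofBase σ a r * x σ a := by
  have h := RingQuot.mkRingHom_rel (GWARel.x_base (σ := σ) (a := a) r)
  rw [map_mul, map_mul] at h
  exact h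

theorem y_mul_ofBase (r : R) : y σ a * ofBase σ a r = ofBase σ a (σ r) * y σ a := by
  have h := RingQuot.mkRingHom_rel (GWARel.y_base (σ := σ) (a := a) r)
  rw [map_mul, map_mul] at h
  exact h

theorem x_mul_y : x σ a * y σ a = ofBase σ a a := by
  have h := RingQuot.mkRingHom_rel (GWARel.x_y (σ := σ) (a := a))
  rw [map_mul] at h
  exact h

end Relations

/-- Every module which is free of rank one over `R` has the form `V_p` in suitable coordinates. -/
theorem exists_coordinates {R : Type u} [CommRing R] {σ : RingAut R} {a : R}
    {V : Type v} [AddCommGroup V] [Module (GWA σ a) V] (hV : IsFreeOfRank σ a 1 V) :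
    ∃ (e : R ≃+ V) (p q : R), σ.symm q * p = a ∧
      (∀ r s, ofBase σ a r • e s = e (r * s)) ∧
      (∀ r, x σ a • e r = e (σ.symm r * p)) ∧ (∀ r, y σ a • e r = e (σ r * q)) := by
  let _ : Module R V := Module.compHom V (ofBase σ a)
  obtain ⟨φ⟩ : Nonempty (V ≃ₗ[R] (Fin 1 → R)) := hV
  let ψ : R ≃ₗ[R] V := (LinearEquiv.funUnique (Fin 1) R R).symm.trans φ.symm
  let e : R ≃+ V := ψ.toAddEquiv
  have hbase (r s : R) : ofBase σ a r • e s = e (r * s) := (map_smul ψ r s).symm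
  have hone (r : R) : e r = ofBase σ a r • e 1 := by rw [hbase, mul_one]
  have hx (r : R) : x σ a • e r = e (σ.symm r * e.symm (x σ a • e 1)) := by
    have h := x_mul_ofBase σ a (σ.symm r)
    rw [RingEquiv.apply_symm_apply] at h
    rw [hone r, ← mul_smul, h, mul_smul, ← hbase, e.apply_symm_apply]
  have hy (r : R) : y σ a • e r = e (σ r * e.symm (y σ a • e 1)) := by
    rw [hone r, ← mul_smul, y_mul_ofBase, mul_smul, ← hbase, e.apply_symm_apply]
  -- Here p and q are the coordinates of x and y applied to the basis vector; evaluating xy = a on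
  -- that vector gives σ⁻¹(q)p = a.
  refine ⟨e, _, _, ?_, hbase, hx, hy⟩
  apply e.injective
  rw [← hx, e.apply_symm_apply, ← mul_smul, x_mul_y, hbase, mul_one]

end GWA

theorem mainTheorem10 {R : Type u} [CommRing R] [IsDomain R] [IsPrincipalIdealRing R]
    (σ : RingAut R) (a : R) (ha : a ≠ 0)
    (horb : ∀ c ∈ IrrClasses R, (sigmaOrbit σ c).Infinite) :
    (∀ (p : R) (hp : p ∣ a),
      Module.length (GWA σ a) (VMod σ a p hp) ≤
        ((1 + irrDeg p * irrDeg (GWA.coDivisor σ a p hp) : ℕ) : ℕ∞)) ∧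
    (∀ (V : Type v) [AddCommGroup V] [Module (GWA σ a) V],
      GWA.IsFreeOfRank σ a 1 V →
        IsFiniteLength (GWA σ a) V ∧
        ((Module.length (GWA σ a) V).toNat : ℝ) ≤ 1 + ((irrDeg a : ℝ) / 2) ^ 2) := by
  refine ⟨fun p hp => ?_, fun V _ _ hV => ?_⟩
  · have h : σ.symm (GWA.coDivisor σ a p hp) * p = a := GWA.symm_coDivisor_mul σ a p hp
    have hq : σ.symm (GWA.coDivisor σ a p hp) ≠ 0 := left_ne_zero_of_mul (h ▸ ha)
    exact GWA.length_le horb (right_ne_zero_of_mul (h ▸ ha)) (by simpa using hq)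
      (AddEquiv.refl R : R ≃+ VMod σ a p hp) VMod.ofBase_smul VMod.x_smul VMod.y_smul
  · obtain ⟨e, p, q, h, hbase, hx, hy⟩ := GWA.exists_coordinates hV
    have hp : p ≠ 0 := right_ne_zero_of_mul (h ▸ ha)
    have hq' : σ.symm q ≠ 0 := left_ne_zero_of_mul (h ▸ ha)
    have hq : q ≠ 0 := by simpa using hq'
    have hlen := GWA.length_le horb hp hq e hbase hx hy
    have hdeg : irrDeg a = irrDeg q + irrDeg p := by
      rw [← h, irrDeg_mul hq' hp, irrDeg_ringEquiv_symm σ hq]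
    refine ⟨Module.length_ne_top_iff.1 (ne_top_of_le_ne_top (ENat.natCast_ne_top _) hlen), ?_⟩
    have hnat := ENat.toNat_le_of_le_natCast hlen
    have hreal : ((Module.length (GWA σ a) V).toNat : ℝ) ≤ 1 + (irrDeg p : ℝ) * irrDeg q := by
      exact_mod_cast hnat
    rw [hdeg]
    push_cast
    -- As deg(a) = deg(p) + deg(q), this is 4·deg(p)·deg(q) ≤ (deg(p) + deg(q))².
    nlinarith [sq_nonneg ((irrDeg p : ℝ) - irrDeg q)]
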